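/- Let $\mathbb F_q$ be the finite field with $q$ elements, let $F_1\subsetneq F_2\subsetneq\cdots\subsetneq F_\lambda\subseteq\mathbb F_q$ be subfields and let $\mu_1,\dots,\mu_\lambda\ge 1$ be integers. Put $s_0=0$, $s_t=\mu_1+\cdots+\mu_t$ for $1\le t\le\lambda$, and $m=s_\lambda\geq 1$. For $1\le i\le m$ let $t_i$ be the unique integer with $s_{t_i-1}<i\le s_{t_i}$, and put $A_i=F_{t_i}$, $d_i=|A_i|$ and $\mathcal A=A_1\times\cdots\times A_m=F_1^{\mu_1}\times\cdots\times F_\lambda^{\mu_\lambda}\subseteq\mathbb F_q^m$. Let $\mathrm{Aff}(\mathcal A)$ be the set of maps $\sigma:\mathcal A\to\mathcal A$ with $\sigma(\mathcal A)=\mathcal A$ that are restrictions of affine maps $X\mapsto MX+b$ with $M\in\mathrm{GL}(m,\mathbb F_q)$ and $b\in\mathbb F_q^m$. Let $u=\sum_{i=1}^{j}(d_i-1)+\ell$ with $0\le j<m$ and $0<\ell<d_{j+1}-1$, and put $r=t_{j+1}$. For $1\le k\le j+1$ with $d_k\ge d_{j+1}-\ell$ and for $\Omega\subseteq A_k$ with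 $|\Omega|=d_k-(d_{j+1}-\ell)$, put $$h_k^\Omega(X_1,\dots,X_m)=\prod_{\substack{i=1\\ i\ne k}}^{j+1}\bigl(1-X_i^{d_i-1}\bigr)\prod_{\omega\in\Omega}(X_k-\omega),$$ and let $N_q^{(k)}(u,\mathcal A)$ be the set of all functions $\mathcal A\to\mathbb F_q$ (equivalently, vectors in $\mathbb F_q^{|\mathcal A|}$) of the form $P\mapsto\gamma\, h_k^\Omega(\sigma(P))$ with $\gamma\in\mathbb F_q^*$, $\sigma\in\mathrm{Aff}(\mathcal A)$, and $\Omega\subseteq A_k$ with $|\Omega|=d_k-(d_{j+1}-\ell)$. If $1\le k\le j+1$ and $t_k=r$ (so that $d_k=d_{j+1}$), then $$\bigl|N_q^{(k)}(u,\mathcal A)\bigr|=(q-1)\Bigl(\prod_{\substack{i=1\\ i\ne k}}^{j+1}d_i\Bigr)\begin{bmatrix}\mu_r\\ j-s_{r-1}\end{bmatrix}_{d_{j+1}}\begin{bmatrix}s_r-j\\ 1\end{bmatrix}_{d_k}\binom{d_k}{d_{j+1}-\ell},$$ where $\begin{bmatrix}n\\ t\end{bmatrix}_{d}$ is the Gaussian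 binomial coefficient, i.e. the number of $t$-dimensional linear subspaces of $\mathbb F_d^{\,n}$. -/

import Mathlib

open scoped BigOperators

/-!
Coordinates are indexed by `Fin m`, so the coordinate `X_{i+1}` of the usual `1`-based numbering
is `i : Fin m`. In the same way the blocks are indexed by `t : Fin lam`, standing for `F_{t+1}`.
-/

namespace NestedCartesian

section Blocks

/-- `s_t = μ_1 + ⋯ + μ_t`, the total size of the first `t` blocks (so `s_0 = 0`). -/
def blockSum {lam : ℕ} (μ : Fin lam → ℕ) (t : ℕ) : ℕ :=
  ∑ i : Fin lam with i.val < t, μ i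

/-- The coordinate `i` lies in the block `t`. In `1`-based numbering (coordinate `i + 1`,
block `t + 1`) this reads `s_t < i + 1 ≤ s_{t+1}`. -/
def InBlock {lam : ℕ} (μ : Fin lam → ℕ) (t : Fin lam) (i : ℕ) : Prop :=
  blockSum μ t.val ≤ i ∧ i < blockSum μ (t.val + 1)

end Blocks

/-- The Gaussian binomial coefficient `[n, t]_d` with `d = |K|`: the number of `t`-dimensional
linear subspaces of `K ^ n`. -/
noncomputable def gaussBinom (K : Type*) [Field K] (n t : ℕ) : ℕ :=
  Nat.card {W : Submodule K (Fin n → K) // Module.finrank K W = t}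

variable {F : Type*} [Field F] {m : ℕ}

/-- `d_i = |A_i|`. -/
noncomputable def fieldCard (A : Fin m → Subfield F) (i : Fin m) : ℕ :=
  Nat.card (A i)

/-- The Cartesian product `𝒜 = A_1 × ⋯ × A_m ⊆ F ^ m`. -/
def cart (A : Fin m → Subfield F) : Set (Fin m → F) :=
  {P | ∀ i, P i ∈ A i}

/-- The evaluation `f ↦ c_f = (f(P))_{P ∈ 𝒜}`. -/
noncomputable def ev (A : Fin m → Subfield F) (f : MvPolynomial (Fin m) F) : cart A → F :=
  fun P => MvPolynomial.eval P.val f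

/-- The affine group associated to `𝒜`: the maps of `𝒜` onto itself that are restrictions of
affine maps `X ↦ M X + b` with `M ∈ GL(m, F)` and `b ∈ F ^ m`. -/
def affGroup (A : Fin m → Subfield F) : Set (cart A → cart A) :=
  {φ | Function.Surjective φ ∧
    ∃ (M : GL (Fin m) F) (b : Fin m → F),
      ∀ P : cart A, (φ P).val = Matrix.mulVec M.val P.val + b}

/-- `h_k^Ω = ∏_{i ≤ j+1, i ≠ k} (1 - X_i ^ (d_i - 1)) * ∏_{ω ∈ Ω} (X_k - ω)`; here `j : Fin m` is
the coordinate with `1`-based number `j + 1`. -/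
noncomputable def hPoly (A : Fin m → Subfield F) (j k : Fin m) (Ω : Finset F) :
    MvPolynomial (Fin m) F :=
  (∏ i : Fin m with i ≤ j ∧ i ≠ k, (1 - MvPolynomial.X i ^ (fieldCard A i - 1))) *
    ∏ ω ∈ Ω, (MvPolynomial.X k - MvPolynomial.C ω)

/-- `N^{(k,Ω)}`: the words `γ • (h_k^Ω ∘ σ)` on `𝒜`, with `γ ∈ Fˣ` and `σ ∈ Aff(𝒜)`. -/
def orbitWords (A : Fin m → Subfield F) (j k : Fin m) (Ω : Finset F) : Set (cart A → F) :=
  {c | ∃ γ : Fˣ, ∃ σ ∈ affGroup A, c = fun P => (γ : F) * ev A (hPoly A j k Ω) (σ P)}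

/-- `u = ∑_{i=1}^{j} (d_i - 1) + ℓ` with `0 ≤ j < m` and `0 < ℓ ≤ d_{j+1} - 1`. For given `u` with
`1 ≤ u ≤ ∑_{i=1}^{m} (d_i - 1)` there is exactly one such pair `(j, ℓ)`. -/
def IsDecomp (A : Fin m → Subfield F) (u : ℕ) (j : Fin m) (ℓ : ℕ) : Prop :=
  0 < ℓ ∧ ℓ ≤ fieldCard A j - 1 ∧ u = (∑ i : Fin m with i < j, (fieldCard A i - 1)) + ℓ

/-- `N^{(k)}(u, 𝒜)`: the union of the sets `N^{(k,Ω)}` over all `Ω ⊆ A_k` with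
`|Ω| = d_k - (d_{j+1} - ℓ)`, where `j` and `ℓ` are determined by `u`. -/
def words (A : Fin m → Subfield F) (u : ℕ) (k : Fin m) : Set (cart A → F) :=
  {c | ∃ (j : Fin m) (ℓ : ℕ), IsDecomp A u j ℓ ∧
    ∃ Ω : Finset F, (∀ ω ∈ Ω, ω ∈ A k) ∧ Ω.card + (fieldCard A j - ℓ) = fieldCard A k ∧
      c ∈ orbitWords A j k Ω}

end NestedCartesian

/-! Let `K` be the field of block `r`, let `s = s_{r-1}` and `e = s_r`, and let `D = K ^ B`, where
`B` is the set of coordinates of that block. An entry `M i l` of an affine permutation of `𝒜` lies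
in `A i`, and it vanishes unless `A l ≤ A i`. Hence the coordinates of `σ P` below `s` depend only
on those of `P`, and the induced map is a bijection. Requiring them to vanish therefore prescribes
the lower coordinates of `P`, with `∏_{i<s} d_i` choices. On that slice the block coordinates of `σ
P` are independent `K`-affine forms in those of `P`, and later coordinates play no role.

Read block coordinates as functionals `x` on `D` and rows of `M` as vectors of `D`. The `j - s` rows
other than `k` cut out a flat `x = ξ` on `U`, where `dim U = j - s`, and row `k` gives `f ∉ U`. The
word is `γ ∏ (x f - ω)` on this flat and zero elsewhere (`exists_glue_of_affine`). Conversely every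
such datum occurs, by completing a basis of `U` and `f` to an invertible matrix
(`exists_affine_of_glue`).

Changing `f` within its line modulo `U` only alters `γ` and `Ω`. With that line in place of `f`, the
parameters are determined by the word because `0 < ℓ ≤ d - 2` (`FlatParam.word_injective`). Counting
`U`, `ξ`, the line, `γ` and `Ω` gives the formula. -/

namespace NestedCartesian

/-! ### Words supported on flats of a dual space, and their number. -/

section DualWords

open Module Submodule

variable {K : Type*} [Field K] {D : Type*} [AddCommGroup D] [Module K D]

/-- A functional on a subspace extends to the whole space with a prescribed value at a vector
outside the subspace. -/
theorem exists_dual_extending (U : Submodule K D) (ξ : Dual K U) {f : D} (hf : f ∉ U) (c : K) :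
    ∃ x : Dual K D, (∀ v : U, x v = ξ v) ∧ x f = c := by
  obtain ⟨x, hx, hxf⟩ := LinearMap.exists_extend_of_notMem ξ hf c
  exact ⟨x, fun v => by rw [← hx]; rfl, hxf⟩

/-- As `exists_dual_extending`, with two prescribed values. -/
theorem exists_dual_extending_pair (U : Submodule K D) (ξ : Dual K U) {f g : D} (hf : f ∉ U)
    (hg : g ∉ U ⊔ span K {f}) (c d : K) :
    ∃ x : Dual K D, (∀ v : U, x v = ξ v) ∧ x f = c ∧ x g = d := by
  obtain ⟨y, hyU, hyf⟩ := exists_dual_extending U ξ hf c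
  obtain ⟨x, hx, hxg⟩ :=
    exists_dual_extending (U ⊔ span K {f}) (y ∘ₗ (U ⊔ span K {f}).subtype) hg d
  refine ⟨x, fun v => ?_, ?_, hxg⟩
  · rw [← hyU]
    exact hx ⟨v, mem_sup_left v.2⟩
  · rw [← hyf]
    exact hx ⟨f, mem_sup_right (mem_span_singleton_self f)⟩

/-- The number of `t`-dimensional subspaces of an `n`-dimensional space is `[n, t]`. -/
theorem natCard_subspaces_eq_gaussBinom [FiniteDimensional K D] {n : ℕ} (hn : finrank K D = n)
    (t : ℕ) : Nat.card {W : Submodule K D // finrank K W = t} = gaussBinom K n t := by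
  have e : D ≃ₗ[K] (Fin n → K) := LinearEquiv.ofFinrankEq _ _ (by simp [hn])
  refine Nat.card_congr ((Submodule.orderIsoMapComap e).toEquiv.subtypeEquiv fun W => ?_)
  rw [← LinearEquiv.finrank_map_eq e W]
  rfl

/-- A line in a quotient is spanned by the class of a vector outside the subspace. -/
theorem exists_span_mkQ_of_finrank_eq_one {U : Submodule K D} (L : Submodule K (D ⧸ U))
    (hL : finrank K L = 1) : ∃ f, f ∉ U ∧ L = span K {U.mkQ f} := by
  obtain ⟨v, hv, h⟩ := finrank_eq_one_iff'.1 hL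
  obtain ⟨f, hf⟩ := U.mkQ_surjective v.1
  refine ⟨f, fun hfU => hv ?_, le_antisymm (fun w hw => ?_) ?_⟩
  · apply Subtype.ext
    rw [← hf]
    simpa using hfU
  · obtain ⟨c, hc⟩ := h ⟨w, hw⟩
    rw [mem_span_singleton, hf]
    exact ⟨c, congrArg Subtype.val hc⟩
  · rw [span_singleton_le_iff_mem, hf]
    exact v.2

theorem finrank_span_mkQ {U : Submodule K D} {f : D} (hf : f ∉ U) :
    finrank K (span K {U.mkQ f}) = 1 :=
  finrank_span_singleton (by simpa using hf)

/-- A vector whose line modulo `U` is spanned by `f` is `k f + v` with `k ≠ 0` and `v ∈ U`. -/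
theorem exists_smul_add_of_span_mkQ_eq {U : Submodule K D} {f g : D} (hg : g ∉ U)
    (h : U.mkQ g ∈ span K {U.mkQ f}) : ∃ k : K, k ≠ 0 ∧ ∃ v : U, g = k • f + v := by
  obtain ⟨k, hk⟩ := mem_span_singleton.1 h
  have hv : g - k • f ∈ U := by
    rw [← Submodule.ker_mkQ U, LinearMap.mem_ker, map_sub, map_smul, hk, sub_self]
  refine ⟨k, ?_, ⟨_, hv⟩, by simp⟩
  rintro rfl
  exact hg (by simpa using hv)

variable (F : Type*) [Field F] [Algebra K F]

open Classical in
/-- The function `γ ∏_{ω ∈ Ω} (x(f) - ω)` on the flat `{x | x = ξ on U}`, extended by zero. -/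
noncomputable def flatWord {F : Type*} [Field F] [Algebra K F] (γ : F) (U : Submodule K D)
    (ξ : Dual K U) (f : D) (Ω : Finset K) (x : Dual K D) : F :=
  if ∀ v : U, x v = ξ v then γ * ∏ ω ∈ Ω, algebraMap K F (x f - ω) else 0

/-- The words `flatWord γ U ξ f Ω` with `dim U = a`, `f ∉ U`, `γ ≠ 0` and `|Ω| = ℓ`. -/
def flatWords (D : Type*) [AddCommGroup D] [Module K D] (a ℓ : ℕ) : Set (Dual K D → F) :=
  {g | ∃ (γ : F) (U : Submodule K D) (ξ : Dual K U) (f : D) (Ω : Finset K),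
    γ ≠ 0 ∧ finrank K U = a ∧ f ∉ U ∧ Ω.card = ℓ ∧ g = flatWord γ U ξ f Ω}

variable {F}

theorem flatWord_ne_zero_iff {γ : F} (hγ : γ ≠ 0) {U : Submodule K D} {ξ : Dual K U} {f : D}
    {Ω : Finset K} {x : Dual K D} :
    flatWord γ U ξ f Ω x ≠ 0 ↔ (∀ v : U, x v = ξ v) ∧ x f ∉ Ω := by
  unfold flatWord
  split_ifs with h
  · simp only [ne_eq, mul_eq_zero, hγ, false_or, Finset.prod_eq_zero_iff, map_eq_zero, sub_eq_zero,
      h, implies_true, true_and]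
    simp
  · simp only [ne_eq, not_true_eq_false, h, false_and]

theorem exists_notMem_pair {K : Type*} [Finite K] {Ω : Finset K} (hΩ : Ω.card + 2 ≤ Nat.card K) :
    ∃ c₁ c₂, c₁ ∉ Ω ∧ c₂ ∉ Ω ∧ c₁ ≠ c₂ := by
  classical
  have := Fintype.ofFinite K
  have h : 1 < (Ωᶜ).card := by
    rw [Finset.card_compl, ← Nat.card_eq_fintype_card]
    omega
  obtain ⟨c₁, h₁, c₂, h₂, h⟩ := Finset.one_lt_card.1 h
  exact ⟨c₁, c₂, by simpa using h₁, by simpa using h₂, h⟩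

section Injectivity

variable {γ γ' : F} {U U' : Submodule K D} {ξ : Dual K U}
  {ξ' : Dual K U'} {f f' : D} {Ω Ω' : Finset K}

/-- A vector of `U` is constant on the common support. Outside `U'` none is: two values of `x f'`
avoid `Ω'`, and vectors outside `U' ⊔ span K {f'}` take arbitrary values. -/
theorem le_of_flatWord_eq [Finite K] (hγ : γ ≠ 0) (hγ' : γ' ≠ 0)
    (hf' : f' ∉ U') (hΩ' : Ω'.card + 2 ≤ Nat.card K)
    (h : flatWord γ U ξ f Ω = flatWord γ' U' ξ' f' Ω') : U ≤ U' := by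
  intro v hv
  by_contra hvU
  have key : ∀ x : Dual K D, (∀ v : U', x v = ξ' v) → x f' ∉ Ω' → x v = ξ ⟨v, hv⟩ := by
    intro x h1 h2
    have h3 := (flatWord_ne_zero_iff hγ').2 ⟨h1, h2⟩
    rw [← h, flatWord_ne_zero_iff hγ] at h3
    exact h3.1 ⟨v, hv⟩
  obtain ⟨c₁, c₂, h₁, h₂, hne⟩ := exists_notMem_pair hΩ'
  by_cases hvf : v ∈ U' ⊔ span K {f'}
  · obtain ⟨w, hw, z, hz, rfl⟩ := mem_sup.1 hvf
    obtain ⟨k, rfl⟩ := mem_span_singleton.1 hz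
    obtain ⟨x, hx, hxf⟩ := exists_dual_extending U' ξ' hf' c₁
    obtain ⟨y, hy, hyf⟩ := exists_dual_extending U' ξ' hf' c₂
    have e1 := key x hx (hxf ▸ h₁)
    have e2 := key y hy (hyf ▸ h₂)
    rw [← e2] at e1
    simp only [map_add, map_smul, hx ⟨w, hw⟩, hy ⟨w, hw⟩, hxf, hyf, smul_eq_mul,
      add_right_inj, mul_eq_mul_left_iff, hne, false_or] at e1
    subst e1
    exact hvU (by simpa using hw)
  · obtain ⟨x, hx, hxf, hxv⟩ :=
      exists_dual_extending_pair U' ξ' hf' hvf c₁ (ξ ⟨v, hv⟩ + 1)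
    have := key x hx (hxf ▸ h₁)
    rw [hxv] at this
    simp at this

theorem dual_eq_of_flatWord_eq [Finite K] (hγ : γ ≠ 0) (hγ' : γ' ≠ 0)
    {ξ' : Dual K U} (hf' : f' ∉ U)
    (hΩ' : Ω'.card + 2 ≤ Nat.card K)
    (h : flatWord γ U ξ f Ω = flatWord γ' U ξ' f' Ω') : ξ = ξ' := by
  obtain ⟨c, -, hc, -⟩ := exists_notMem_pair hΩ'
  obtain ⟨x, hx, hxf⟩ := exists_dual_extending U ξ' hf' c
  have h3 := (flatWord_ne_zero_iff hγ').2 ⟨hx, hxf ▸ hc⟩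
  rw [← h, flatWord_ne_zero_iff hγ] at h3
  ext v
  rw [← hx v, h3.1 v]

/-- If `f'` were independent of `f` modulo `U`, one could choose `x f ∈ Ω` and `x f' ∉ Ω'` at once,
so that only one of the two words vanishes at `x`. -/
theorem span_mkQ_eq_of_flatWord_eq [Finite K] (hγ : γ ≠ 0) (hγ' : γ' ≠ 0)
    (hf : f ∉ U) (hf' : f' ∉ U)
    (hΩ : Ω.Nonempty) (hΩ' : Ω'.card + 2 ≤ Nat.card K)
    (h : flatWord γ U ξ f Ω = flatWord γ' U ξ f' Ω') :
    span K {U.mkQ f} = span K {U.mkQ f'} := by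
  have hmem : f' ∈ U ⊔ span K {f} := by
    by_contra hcon
    obtain ⟨c, -, hc, -⟩ := exists_notMem_pair hΩ'
    obtain ⟨ω, hω⟩ := hΩ
    obtain ⟨x, hx, hxf, hxf'⟩ := exists_dual_extending_pair U ξ hf hcon ω c
    have h3 := (flatWord_ne_zero_iff hγ').2 ⟨hx, hxf' ▸ hc⟩
    rw [← h, flatWord_ne_zero_iff hγ, hxf] at h3
    exact h3.2 hω
  obtain ⟨w, hw, z, hz, rfl⟩ := mem_sup.1 hmem
  obtain ⟨k, rfl⟩ := mem_span_singleton.1 hz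
  have hk : k ≠ 0 := by
    rintro rfl
    exact hf' (by simpa using hw)
  have hw0 : U.mkQ w = 0 := by simpa using hw
  rw [map_add, hw0, zero_add, map_smul, span_singleton_smul_eq (IsUnit.mk0 k hk)]

/-- On the flat `x f` takes every value in `K`, so the zeros of the word there recover `Ω`. -/
theorem finset_eq_of_flatWord_eq (hγ : γ ≠ 0) (hγ' : γ' ≠ 0)
    (hf : f ∉ U)
    (h : flatWord γ U ξ f Ω = flatWord γ' U ξ f Ω') : Ω = Ω' := by
  ext c
  obtain ⟨x, hx, hxf⟩ := exists_dual_extending U ξ hf c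
  have h1 := flatWord_ne_zero_iff hγ (U := U) (ξ := ξ) (f := f) (Ω := Ω) (x := x)
  rw [h, flatWord_ne_zero_iff hγ', hxf] at h1
  tauto

theorem scalar_eq_of_flatWord_eq [Finite K] (hf : f ∉ U) (hΩ : Ω.card + 2 ≤ Nat.card K)
    (h : flatWord γ U ξ f Ω = flatWord γ' U ξ f Ω) : γ = γ' := by
  obtain ⟨c, -, hc, -⟩ := exists_notMem_pair hΩ
  obtain ⟨x, hx, hxf⟩ := exists_dual_extending U ξ hf c
  have h1 := congrFun h x
  simp only [flatWord, hx, implies_true, if_true, hxf] at h1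
  refine mul_right_cancel₀ (Finset.prod_ne_zero_iff.2 fun ω hω => ?_) h1
  rw [Ne, map_eq_zero, sub_eq_zero]
  rintro rfl
  exact hc hω

end Injectivity

/-- On a flat, a vector `g = k f + v` with `v ∈ U` gives the same words as `f`. -/
theorem flatWord_smul_add (γ : F) (U : Submodule K D) (ξ : Dual K U) (f : D) (Ω : Finset K)
    {k : K} (hk : k ≠ 0) (v : U) :
    ∃ Ω' : Finset K, Ω'.card = Ω.card ∧
      flatWord γ U ξ (k • f + v) Ω = flatWord (γ * algebraMap K F k ^ Ω.card) U ξ f Ω' := by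
  classical
  -- From `x (k • f + v) - ω = k * (x f - k⁻¹ * (ω - ξ v))`; each of the `Ω.card` factors
  -- contributes one `k` to the scalar.
  let e : K ≃ K := (Equiv.subRight (ξ v)).trans (Equiv.mulLeft₀ k⁻¹ (inv_ne_zero hk))
  refine ⟨Ω.map e.toEmbedding, by simp, ?_⟩
  ext x
  unfold flatWord
  split_ifs with h
  · rw [Finset.prod_map, mul_assoc, ← Finset.prod_const, ← Finset.prod_mul_distrib]
    congr 1
    refine Finset.prod_congr rfl fun ω _ => ?_
    rw [← map_mul]
    congr 1
    simp [e, h v]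
    field_simp
    ring
  · rfl

/-- The parameters of a word in `flatWords F D a ℓ`. -/
abbrev FlatParam (K F D : Type*) [Field K] [Field F] [AddCommGroup D] [Module K D] (a ℓ : ℕ) :=
  Σ U : {U : Submodule K D // finrank K U = a},
    Dual K U.1 × {L : Submodule K (D ⧸ U.1) // finrank K L = 1} × Fˣ × {Ω : Finset K // Ω.card = ℓ}

/-- A representative of a line in a quotient. -/
noncomputable def lineRep {U : Submodule K D} (L : {L : Submodule K (D ⧸ U) // finrank K L = 1}) :
    D :=
  (exists_span_mkQ_of_finrank_eq_one L.1 L.2).choose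

theorem lineRep_notMem {U : Submodule K D} (L : {L : Submodule K (D ⧸ U) // finrank K L = 1}) :
    lineRep L ∉ U :=
  (exists_span_mkQ_of_finrank_eq_one L.1 L.2).choose_spec.1

theorem span_lineRep {U : Submodule K D} (L : {L : Submodule K (D ⧸ U) // finrank K L = 1}) :
    L.1 = span K {U.mkQ (lineRep L)} :=
  (exists_span_mkQ_of_finrank_eq_one L.1 L.2).choose_spec.2

/-- The word with given parameters. -/
noncomputable def FlatParam.word {a ℓ : ℕ} (p : FlatParam K F D a ℓ) : Dual K D → F :=
  flatWord (p.2.2.2.1 : F) p.1.1 p.2.1 (lineRep p.2.2.1) p.2.2.2.2.1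

theorem FlatParam.word_injective [Finite K] {a ℓ : ℕ} (hℓ : 0 < ℓ) (hℓ' : ℓ + 2 ≤ Nat.card K) :
    Function.Injective (FlatParam.word : FlatParam K F D a ℓ → Dual K D → F) := by
  rintro ⟨⟨U, hU⟩, ξ, L, γ, ⟨Ω, hΩ⟩⟩ ⟨⟨U', hU'⟩, ξ', L', γ', ⟨Ω', hΩ'⟩⟩ h
  simp only [FlatParam.word] at h
  have hc : Ω.card + 2 ≤ Nat.card K := hΩ ▸ hℓ'
  have hc' : Ω'.card + 2 ≤ Nat.card K := hΩ' ▸ hℓ'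
  have hne : Ω.Nonempty := Finset.card_pos.1 (hΩ ▸ hℓ)
  have hUU : U = U' := le_antisymm
    (le_of_flatWord_eq γ.ne_zero γ'.ne_zero (lineRep_notMem L') hc' h)
    (le_of_flatWord_eq γ'.ne_zero γ.ne_zero (lineRep_notMem L) hc h.symm)
  subst hUU
  obtain rfl := dual_eq_of_flatWord_eq γ.ne_zero γ'.ne_zero (lineRep_notMem L') hc' h
  have hLL := span_mkQ_eq_of_flatWord_eq γ.ne_zero γ'.ne_zero (lineRep_notMem L)
    (lineRep_notMem L') hne hc' h
  rw [← span_lineRep, ← span_lineRep] at hLL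
  obtain rfl := Subtype.ext hLL
  obtain rfl := finset_eq_of_flatWord_eq γ.ne_zero γ'.ne_zero (lineRep_notMem L) h
  obtain rfl := Units.ext (scalar_eq_of_flatWord_eq (lineRep_notMem L) hc h)
  rfl

/-- Replacing `f` by the chosen representative of its line is absorbed into `γ` and `Ω` by
`flatWord_smul_add`. -/
theorem FlatParam.range_word {a ℓ : ℕ} :
    Set.range (FlatParam.word : FlatParam K F D a ℓ → Dual K D → F) = flatWords F D a ℓ := by
  ext g
  constructor
  · rintro ⟨⟨⟨U, hU⟩, ξ, L, γ, ⟨Ω, hΩ⟩⟩, rfl⟩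
    exact ⟨γ, U, ξ, _, Ω, γ.ne_zero, hU, lineRep_notMem L, hΩ, rfl⟩
  · rintro ⟨γ, U, ξ, f, Ω, hγ, hU, hf, hΩ, rfl⟩
    let L : {L : Submodule K (D ⧸ U) // finrank K L = 1} := ⟨_, finrank_span_mkQ hf⟩
    obtain ⟨k, hk, v, hv⟩ := exists_smul_add_of_span_mkQ_eq (f := lineRep L) hf
      (by rw [← span_lineRep]; exact mem_span_singleton_self _)
    obtain ⟨Ω', hΩ', h⟩ := flatWord_smul_add γ U ξ (lineRep L) Ω hk v
    have hk' : algebraMap K F k ≠ 0 := by simpa using hk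
    refine ⟨⟨⟨U, hU⟩, ξ, L, Units.mk0 _ (mul_ne_zero hγ (pow_ne_zero Ω.card hk')),
      ⟨Ω', hΩ'.trans hΩ⟩⟩, ?_⟩
    rw [hv, h]
    rfl

theorem natCard_finset_card_eq (K : Type*) [Finite K] (ℓ : ℕ) :
    Nat.card {Ω : Finset K // Ω.card = ℓ} = (Nat.card K).choose ℓ := by
  have := Fintype.ofFinite K
  rw [Nat.card_eq_fintype_card, Nat.card_eq_fintype_card, Fintype.card_finset_len]

/-- The number of words in `flatWords F D a ℓ`. -/
theorem ncard_flatWords [Finite F] [FiniteDimensional K D] {n a ℓ : ℕ}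
    (hn : finrank K D = n) (hℓ : 0 < ℓ) (hℓ' : ℓ + 2 ≤ Nat.card K) :
    (flatWords F D a ℓ : Set (Dual K D → F)).ncard =
      (Nat.card F - 1) * Nat.card K ^ a * gaussBinom K n a * gaussBinom K (n - a) 1 *
        (Nat.card K).choose ℓ := by
  have : Finite K := Finite.of_injective _ (algebraMap K F).injective
  have : Finite D := Module.finite_of_finite K
  have hfin : ∀ U : Submodule K D, Finite (Dual K U) := fun U => Module.finite_of_finite K
  have hsub : ∀ U : Submodule K D, Finite (Submodule K (D ⧸ U)) := fun U =>
    have : Finite (D ⧸ U) := Finite.of_surjective _ U.mkQ_surjective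
    Finite.of_injective _ SetLike.coe_injective
  have : Finite (Submodule K D) := Finite.of_injective _ SetLike.coe_injective
  have := Fintype.ofFinite {U : Submodule K D // finrank K U = a}
  rw [← FlatParam.range_word, Set.ncard_range_of_injective (FlatParam.word_injective hℓ hℓ'),
    Nat.card_sigma]
  have hterm : ∀ U : {U : Submodule K D // finrank K U = a},
      Nat.card (Dual K U.1 × {L : Submodule K (D ⧸ U.1) // finrank K L = 1} × Fˣ ×
        {Ω : Finset K // Ω.card = ℓ}) =
      Nat.card K ^ a * (gaussBinom K (n - a) 1 * ((Nat.card F - 1) * (Nat.card K).choose ℓ)) := by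
    rintro ⟨U, hU⟩
    rw [Nat.card_prod, Nat.card_prod, Nat.card_prod, Nat.card_units, natCard_finset_card_eq,
      natCard_subspaces_eq_gaussBinom (n := n - a), Module.natCard_eq_pow_finrank (K := K),
      Subspace.dual_finrank_eq, hU]
    rw [Submodule.finrank_quotient, hn, hU]
  rw [Finset.sum_congr rfl fun U _ => hterm U, Finset.sum_const, Finset.card_univ,
    ← Nat.card_eq_fintype_card, natCard_subspaces_eq_gaussBinom hn, smul_eq_mul]
  ring

end DualWords

end NestedCartesian

namespace NestedCartesian

/-! ### Independent families, evaluation of `hPoly`, and entries of affine maps. -/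

section LinearAlgebra

open Module

variable {K : Type*} [Field K] {D : Type*} [AddCommGroup D] [Module K D]

/-- Vectors on which a functional can take arbitrary values are linearly independent. -/
theorem linearIndependent_of_forall_exists_dual {ι : Type*} [Finite ι] {φ : ι → D}
    (h : ∀ y : ι → K, ∃ z : Dual K D, ∀ i, z (φ i) = y i) : LinearIndependent K φ := by
  classical
  have := Fintype.ofFinite ι
  rw [Fintype.linearIndependent_iff]
  intro g hg i
  obtain ⟨z, hz⟩ := h (Pi.single i 1)
  have := congrArg z hg
  simpa [hz, Pi.single_apply] using this

/-- A partial family of linearly independent vectors, indexed by a set of size the dimension,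
extends to a linearly independent family. -/
theorem exists_linearIndependent_extending [FiniteDimensional K D] {ι : Type*} [Fintype ι]
    (hι : Fintype.card ι = finrank K D) {S : Set ι} {φ : ι → D} (hφ : LinearIndepOn K φ S) :
    ∃ ψ : ι → D, LinearIndependent K ψ ∧ ∀ i ∈ S, ψ i = φ i := by
  classical
  have hi := hφ.id_image
  have hb := Basis.extend hi
  have hfin : Fintype (hi.extend (Set.subset_univ _)) := FiniteDimensional.fintypeBasisIndex hb
  have hsub : φ '' S ⊆ hi.extend (Set.subset_univ _) := hi.subset_extend _
  -- The injection `φ` on `S` extends to a bijection from `ι` onto a basis containing `φ '' S`.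
  obtain ⟨g, hg⟩ := Set.MapsTo.exists_equiv_extend_of_card_eq
    (t := (hi.extend (Set.subset_univ _)).toFinset) (s := S) (f := φ)
    (by rw [hι, finrank_eq_card_basis hb, Set.toFinset_card])
    (fun i hiS => by simpa using hsub ⟨i, hiS, rfl⟩) hφ.injOn
  refine ⟨fun i => g i, ?_, hg⟩
  have hli : LinearIndependent K
      (fun x : hi.extend (Set.subset_univ (φ '' S)) => (x : D)) := by
    have := (Basis.extend hi).linearIndependent
    rwa [Basis.coe_extend] at this
  exact hli.comp (fun i => ⟨g i, Set.mem_toFinset.1 (g i).2⟩) fun i i' h =>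
    g.injective (Subtype.ext (Subtype.mk.inj h))

end LinearAlgebra

section Evaluation

variable {F : Type*} [Field F] {m : ℕ} (A : Fin m → Subfield F)

theorem one_sub_pow_fieldCard [Finite F] (i : Fin m) {x : F} [Decidable (x = 0)] (hx : x ∈ A i) :
    1 - x ^ (fieldCard A i - 1) = if x = 0 then 1 else 0 := by
  have := Fintype.ofFinite (A i)
  have h1 : 1 < fieldCard A i := Finite.one_lt_card
  split_ifs with h
  · rw [h, zero_pow (by omega), sub_zero]
  · have h2 := FiniteField.pow_card_sub_one_eq_one (⟨x, hx⟩ : A i)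
      (fun h' => h (congrArg Subtype.val h'))
    rw [← Nat.card_eq_fintype_card] at h2
    have h3 : x ^ (fieldCard A i - 1) = 1 := congrArg Subtype.val h2
    rw [h3, sub_self]

open Classical in
theorem ev_hPoly [Finite F] (j k : Fin m) (Ω : Finset F) (Q : cart A) :
    ev A (hPoly A j k Ω) Q =
      if ∀ i, i ≤ j → i ≠ k → Q.1 i = 0 then ∏ ω ∈ Ω, (Q.1 k - ω) else 0 := by
  have h : ev A (hPoly A j k Ω) Q =
      (∏ i : Fin m with i ≤ j ∧ i ≠ k, if Q.1 i = 0 then (1 : F) else 0) *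
        ∏ ω ∈ Ω, (Q.1 k - ω) := by
    simp only [ev, hPoly, map_mul, map_prod, map_sub, map_one, map_pow, MvPolynomial.eval_X,
      MvPolynomial.eval_C]
    congr 1
    exact Finset.prod_congr rfl fun i _ => one_sub_pow_fieldCard A i (Q.2 i)
  rw [h, Finset.prod_ite_zero]
  simp

end Evaluation

section Affine

variable {F : Type*} [Field F] {m : ℕ} {A : Fin m → Subfield F}

/-- Compare coordinate `i` of the images of `0` and of `a` times the `l`-th unit vector: both lie in
`A i`. -/
theorem matrix_entry_mul_mem {σ : cart A → cart A} {M : Matrix (Fin m) (Fin m) F} {b : Fin m → F}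
    (h : ∀ P : cart A, (σ P).val = M.mulVec P.val + b) (i l : Fin m) {a : F} (ha : a ∈ A l) :
    M i l * a ∈ A i := by
  have h0 : (0 : Fin m → F) ∈ cart A := fun i => zero_mem _
  have h1 : Pi.single l a ∈ cart A := fun i => by
    by_cases hi : i = l
    · subst hi; simpa using ha
    · simp [hi]
  have e0 := congrFun (h ⟨_, h0⟩) i
  have e1 := congrFun (h ⟨_, h1⟩) i
  have := sub_mem ((σ ⟨_, h1⟩).2 i) ((σ ⟨_, h0⟩).2 i)
  rw [e0, e1] at this
  simpa [mul_comm] using this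

theorem matrix_entry_mem {σ : cart A → cart A} {M : Matrix (Fin m) (Fin m) F} {b : Fin m → F}
    (h : ∀ P : cart A, (σ P).val = M.mulVec P.val + b) (i l : Fin m) : M i l ∈ A i := by
  simpa using matrix_entry_mul_mem h i l (one_mem (A l))

theorem matrix_entry_eq_zero {σ : cart A → cart A} {M : Matrix (Fin m) (Fin m) F} {b : Fin m → F}
    (h : ∀ P : cart A, (σ P).val = M.mulVec P.val + b) {i l : Fin m} (hil : ¬ A l ≤ A i) :
    M i l = 0 := by
  by_contra h0
  refine hil fun a ha => ?_
  have := mul_mem (inv_mem (matrix_entry_mem h i l)) (matrix_entry_mul_mem h i l ha)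
  rwa [inv_mul_cancel_left₀ h0] at this

end Affine

/-! ### Splitting points into lower and block coordinates; words glued from a slice. -/

section Glue

open Module

/-- The coordinates below `s`. -/
abbrev Low (m s : ℕ) := {i : Fin m // i.val < s}

/-- The coordinates in `[s, e)`. -/
abbrev Blk (m s e : ℕ) := {i : Fin m // s ≤ i.val ∧ i.val < e}

variable {F : Type*} [Field F] {m : ℕ} {A : Fin m → Subfield F} {s e : ℕ} {K : Subfield F}

/-- The coordinates of a point below `s`. -/
def lowPart (s : ℕ) (P : cart A) : ∀ i : Low m s, A i := fun i => ⟨P.1 i, P.2 i⟩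

/-- The coordinates of a point in a block on which `A` takes the value `K`. -/
def blkPart (hK : ∀ i : Fin m, s ≤ i.val ∧ i.val < e → A i = K) (P : cart A) : Blk m s e → K :=
  fun i => ⟨P.1 i, hK i i.2 ▸ P.2 i⟩

variable (hK : ∀ i : Fin m, s ≤ i.val ∧ i.val < e → A i = K)

theorem exists_point (c : ∀ i : Low m s, A i) (x : Blk m s e → K) :
    ∃ P : cart A, lowPart s P = c ∧ blkPart hK P = x := by
  classical
  refine ⟨⟨fun i => if h : i.val < s then c ⟨i, h⟩ else
    if h' : s ≤ i.val ∧ i.val < e then x ⟨i, h'⟩ else 0, fun i => ?_⟩, ?_, ?_⟩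
  · dsimp only
    split_ifs with h h'
    · exact (c ⟨i, h⟩).2
    · rw [hK i h']
      exact (x ⟨i, h'⟩).2
    · exact zero_mem _
  · ext i
    simp [lowPart, i.2]
  · ext i
    simp [blkPart, i.2]

/-- The functional on `K ^ B` given by the block coordinates of a point. -/
noncomputable def blkDual (P : cart A) : Dual K (Blk m s e → K) :=
  dotProductEquiv K (Blk m s e) (blkPart hK P)

theorem blkDual_apply (P : cart A) (v : Blk m s e → K) :
    blkDual hK P v = ∑ i, blkPart hK P i * v i := rfl

theorem exists_point_dual (c : ∀ i : Low m s, A i) (x : Dual K (Blk m s e → K)) :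
    ∃ P : cart A, lowPart s P = c ∧ blkDual hK P = x := by
  obtain ⟨y, rfl⟩ := (dotProductEquiv K (Blk m s e)).surjective x
  obtain ⟨P, h1, h2⟩ := exists_point hK c y
  exact ⟨P, h1, by rw [blkDual, h2]⟩

open Classical in
/-- The function `g` of the block coordinates, restricted to the points with lower coordinates
`c`. -/
noncomputable def glue (p : (∀ i : Low m s, A i) × (Dual K (Blk m s e → K) → F)) (P : cart A) : F :=
  if lowPart s P = p.1 then p.2 (blkDual hK P) else 0

/-- A nonzero `g` makes the glued word nonzero somewhere on its slice, which reveals `c`; then `g`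
is read off there. -/
theorem glue_injOn {G : Set (Dual K (Blk m s e → K) → F)} (hG : ∀ g ∈ G, g ≠ 0) :
    Set.InjOn (glue hK) (Set.univ ×ˢ G) := by
  rintro ⟨c, g⟩ ⟨-, hg⟩ ⟨c', g'⟩ - h
  obtain ⟨x, hx⟩ := Function.ne_iff.1 (hG g hg)
  have hcc : c = c' := by
    obtain ⟨P, h1, rfl⟩ := exists_point_dual hK c x
    have := congrFun h P
    simp only [glue, h1, if_true] at this
    by_contra hne
    rw [if_neg (h1 ▸ hne)] at this
    exact hx this
  subst hcc
  congr 1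
  ext x
  obtain ⟨P, h1, rfl⟩ := exists_point_dual hK c x
  simpa [glue, h1] using congrFun h P

theorem natCard_lowPart : Nat.card (∀ i : Low m s, A i) = ∏ i : Low m s, fieldCard A i :=
  Nat.card_pi

/-- The rows of the block which cut out the flat. -/
def flatRows (s e : ℕ) (j k : Fin m) : Set (Blk m s e) := {i | i.1 ≤ j ∧ i.1 ≠ k}

theorem ncard_flatRows {j k : Fin m} (hsk : s ≤ k.val) (hkj : k ≤ j) (hje : j.val < e) :
    (flatRows s e j k).ncard = j.val - s := by
  have hinj : Function.Injective (fun i : Blk m s e => i.1.val) := fun i i' h =>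
    Subtype.ext (Fin.ext h)
  have himg : (fun i : Blk m s e => i.1.val) '' flatRows s e j k =
      ((Finset.Icc s j.val).erase k.val : Finset ℕ) := by
    ext n
    simp only [flatRows, Set.mem_image, Set.mem_ofPred_eq, Finset.coe_erase, Finset.coe_Icc,
      Set.mem_sdiff, Set.mem_Icc, Set.mem_singleton_iff]
    constructor
    · rintro ⟨i, ⟨h1, h2⟩, rfl⟩
      exact ⟨⟨i.2.1, h1⟩, fun h => h2 (Fin.ext h)⟩
    · rintro ⟨⟨h1, h2⟩, h3⟩
      exact ⟨⟨⟨n, h2.trans_lt j.2⟩, h1, h2.trans_lt hje⟩,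
        ⟨h2, fun h => h3 (congrArg Fin.val h)⟩, rfl⟩
  rw [← Set.ncard_image_of_injective _ hinj, himg, Set.ncard_coe_finset,
    Finset.card_erase_of_mem (Finset.mem_Icc.2 ⟨hsk, hkj⟩), Nat.card_Icc]
  omega

/-- A map of `𝒜` which, relative to a base point `P₀`, is given on the block by the functionals
`φ i` turns `h_k^Ω` into a glued word. -/
theorem word_eq_glue [Finite F] {j k : Fin m} (hsk : s ≤ k.val) (hkj : k ≤ j) (hje : j.val < e)
    {σ : cart A → cart A} {P₀ : cart A} {φ : Blk m s e → Blk m s e → K}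
    (hlow : ∀ P, lowPart s (σ P) = 0 ↔ lowPart s P = lowPart s P₀)
    (hblk : ∀ P, lowPart s P = lowPart s P₀ → ∀ i : Blk m s e,
      (σ P).1 i = ((blkDual hK P - blkDual hK P₀) (φ i) : K))
    (kb : Blk m s e) (hkb : kb.1 = k) (γ : F) (Ω : Finset K) :
    (fun P => γ * ev A (hPoly A j k (Ω.map (Function.Embedding.subtype _))) (σ P)) =
      glue hK (lowPart s P₀, flatWord γ (Submodule.span K (φ '' flatRows s e j k))
        (blkDual hK P₀ ∘ₗ Submodule.subtype _) (φ kb)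
        (Ω.map (Equiv.addRight (blkDual hK P₀ (φ kb))).toEmbedding)) := by
  classical
  ext P
  rw [ev_hPoly]
  unfold glue flatWord
  dsimp only
  by_cases hc : lowPart s P = lowPart s P₀
  · rw [if_pos hc]
    have hiff : (∀ i, i ≤ j → i ≠ k → (σ P).1 i = 0) ↔
        ∀ v : Submodule.span K (φ '' flatRows s e j k), blkDual hK P v =
          (blkDual hK P₀ ∘ₗ Submodule.subtype _) v := by
      constructor
      · intro h
        have hle : Submodule.span K (φ '' flatRows s e j k) ≤
            LinearMap.ker (blkDual hK P - blkDual hK P₀) := by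
          rw [Submodule.span_le]
          rintro _ ⟨i, hi, rfl⟩
          have := h i.1 hi.1 hi.2
          rw [hblk P hc] at this
          exact_mod_cast this
        intro v
        have := hle v.2
        rw [LinearMap.mem_ker, LinearMap.sub_apply, sub_eq_zero] at this
        exact this
      · intro h i hij hik
        by_cases his : i.val < s
        · exact congrArg Subtype.val (congrFun ((hlow P).2 hc) ⟨i, his⟩)
        · have hiB : s ≤ i.val ∧ i.val < e := ⟨not_lt.1 his, lt_of_le_of_lt hij hje⟩
          have := h ⟨φ ⟨i, hiB⟩, Submodule.subset_span ⟨_, ⟨hij, hik⟩, rfl⟩⟩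
          rw [hblk P hc ⟨i, hiB⟩, LinearMap.sub_apply, this]
          simp
    simp only [hiff, mul_ite, mul_zero]
    refine if_congr Iff.rfl ?_ rfl
    rw [Finset.prod_map, Finset.prod_map]
    congr 1
    -- With `x₀` the functional of `P₀`, `(x - x₀) (φ kb) - ω = x (φ kb) - (ω + x₀ (φ kb))`, hence
    -- the translate of `Ω`.
    refine Finset.prod_congr rfl fun ω _ => ?_
    have := hblk P hc kb
    rw [hkb] at this
    rw [this]
    simp only [Function.Embedding.subtype_apply, Equiv.coe_toEmbedding, Equiv.coe_addRight,
      LinearMap.sub_apply]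
    rw [sub_add_eq_sub_sub, sub_right_comm]
    rfl
  -- Off the slice some coordinate of `σ P` below `s` is nonzero; its index is `≤ j` and differs
  -- from `k`, so its factor vanishes.
  · rw [if_neg hc, if_neg, mul_zero]
    intro h
    refine hc ((hlow P).1 ?_)
    ext i
    exact h i.1 (Fin.le_def.2 (by have := i.2; have := Fin.le_def.1 hkj; omega))
      (fun hik => by have := i.2; rw [hik] at this; omega)

end Glue

end NestedCartesian

namespace NestedCartesian

/-! ### Orbit words are exactly the glued words. -/

section Orbit

open Module

variable {F : Type*} [Field F] {m : ℕ} {A : Fin m → Subfield F} {s e : ℕ} {K : Subfield F}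
  (hK : ∀ i : Fin m, s ≤ i.val ∧ i.val < e → A i = K)

/-- For an affine permutation `σ` of `𝒜` with `σ P₀ = 0`, the lower coordinates of `σ P` vanish
exactly when `P` and `P₀` have the same lower coordinates. -/
theorem lowPart_eq_zero_iff_of_affine [Finite F]
    (hlow : ∀ i l : Fin m, i.val < s → s ≤ l.val → ¬ A l ≤ A i)
    {σ : cart A → cart A} (hσ : Function.Surjective σ) {M : Matrix (Fin m) (Fin m) F}
    {b : Fin m → F} (h : ∀ P : cart A, (σ P).val = M.mulVec P.val + b) {P₀ : cart A}
    (hP₀ : (σ P₀).val = 0) (P : cart A) :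
    lowPart s (σ P) = 0 ↔ lowPart s P = lowPart s P₀ := by
  have hdep : ∀ P Q : cart A, lowPart s P = lowPart s Q →
      lowPart s (σ P) = lowPart s (σ Q) := by
    intro P Q hPQ
    ext i
    simp only [lowPart, h, Pi.add_apply, add_left_inj, Matrix.mulVec, dotProduct]
    refine Finset.sum_congr rfl fun l _ => ?_
    by_cases hl : l.val < s
    · rw [show P.1 l = Q.1 l from congrArg Subtype.val (congrFun hPQ ⟨l, hl⟩)]
    · rw [matrix_entry_eq_zero h (hlow i l i.2 (not_lt.1 hl)), zero_mul, zero_mul]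
  -- The range from `s` to `s` is empty, so the block condition is vacuous and `⊤` is a dummy field.
  have hex : ∀ c : ∀ i : Low m s, A i, ∃ P : cart A, lowPart s P = c := fun c =>
    (exists_point (e := s) (K := ⊤) (fun i hi => absurd hi.2 (not_lt.2 hi.1)) c 0).imp
      fun _ h => h.1
  choose pt hpt using hex
  -- The induced self-map of the finite set of lower parts is surjective, hence injective.
  have hsurj : Function.Surjective fun c => lowPart s (σ (pt c)) := by
    intro d
    obtain ⟨P, hP⟩ := hσ (pt d)
    refine ⟨lowPart s P, ?_⟩
    dsimp only
    rw [hdep _ P (hpt _), hP, hpt]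
  have hinj := Finite.injective_iff_surjective.2 hsurj
  have h0 : lowPart s (σ P₀) = 0 := by
    ext i
    exact congrFun hP₀ i
  rw [← h0]
  refine ⟨fun hP => hinj ?_, fun hP => hdep _ _ hP⟩
  dsimp only
  rw [hdep _ P (hpt _), hP, hdep _ P₀ (hpt _)]

theorem coe_blkDual_sub_apply (P P₀ : cart A) (v : Blk m s e → K) :
    (((blkDual hK P - blkDual hK P₀) v : K) : F) =
      ∑ l : Blk m s e, (v l : F) * (P.1 l - P₀.1 l) := by
  rw [LinearMap.sub_apply, blkDual_apply, blkDual_apply, ← Finset.sum_sub_distrib,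
    AddSubmonoidClass.coe_finsetSum]
  refine Finset.sum_congr rfl fun l _ => ?_
  simp only [blkPart, AddSubgroupClass.coe_sub, MulMemClass.coe_mul]
  ring

/-- Every word of an orbit is a glued word. -/
theorem exists_glue_of_affine [Finite F]
    (hlow : ∀ i l : Fin m, i.val < s → s ≤ l.val → ¬ A l ≤ A i)
    (hhigh : ∀ i l : Fin m, i.val < e → e ≤ l.val → ¬ A l ≤ A i)
    {j k : Fin m} (hsk : s ≤ k.val) (hkj : k ≤ j) (hje : j.val < e)
    {σ : cart A → cart A} (hσ : σ ∈ affGroup A) {γ : F} (hγ : γ ≠ 0) (Ω : Finset K) :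
    (fun P => γ * ev A (hPoly A j k (Ω.map (Function.Embedding.subtype _))) (σ P)) ∈
      glue hK '' (Set.univ ×ˢ flatWords F (Blk m s e → K) (j.val - s) Ω.card) := by
  classical
  obtain ⟨hsurj, M, b, h⟩ := hσ
  obtain ⟨P₀, hP₀⟩ := hsurj ⟨0, fun i => zero_mem _⟩
  replace hP₀ : (σ P₀).val = 0 := by rw [hP₀]
  have hiff := lowPart_eq_zero_iff_of_affine hlow hsurj h hP₀
  let φ : Blk m s e → Blk m s e → K := fun i l =>
    ⟨M.val i l, hK i i.2 ▸ matrix_entry_mem h i l⟩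
  have hblk : ∀ P, lowPart s P = lowPart s P₀ → ∀ i : Blk m s e,
      (σ P).1 i = ((blkDual hK P - blkDual hK P₀) (φ i) : K) := by
    intro P hP i
    have h1 : (σ P).1 i = ∑ l, M.val i l * (P.1 l - P₀.1 l) := by
      rw [← sub_zero ((σ P).1 i), ← Pi.zero_apply (M := fun _ => F) i.1, ← hP₀, h, h]
      simp only [Pi.add_apply, add_sub_add_right_eq_sub, Matrix.mulVec, dotProduct,
        ← Finset.sum_sub_distrib, mul_sub]
    rw [h1, coe_blkDual_sub_apply,
      ← Fintype.sum_subtype_add_sum_subtype (fun l : Fin m => s ≤ l.val ∧ l.val < e)]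
    refine (add_eq_left.2 (Finset.sum_eq_zero fun l _ => ?_))
    by_cases hl : l.1.val < s
    · rw [show P.1 l = P₀.1 l from congrArg Subtype.val (congrFun hP ⟨l, hl⟩), sub_self, mul_zero]
    · have hle : e ≤ l.1.val := by
        by_contra hcon
        exact l.2 ⟨not_lt.1 hl, not_le.1 hcon⟩
      rw [matrix_entry_eq_zero h (hhigh i l i.2.2 hle), zero_mul]
  -- By surjectivity of `σ`, the rows take arbitrary values on the slice of `P₀`.
  have hli : LinearIndependent K φ := by
    refine linearIndependent_of_forall_exists_dual fun y => ?_
    obtain ⟨Q, hQ, hQy⟩ := exists_point hK 0 y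
    obtain ⟨P, rfl⟩ := hsurj Q
    refine ⟨blkDual hK P - blkDual hK P₀, fun i => Subtype.ext ?_⟩
    rw [← hblk P ((hiff P).1 hQ), ← hQy]
    rfl
  have hkb : s ≤ k.val ∧ k.val < e := ⟨hsk, lt_of_le_of_lt hkj hje⟩
  rw [word_eq_glue hK hsk hkj hje hiff hblk ⟨k, hkb⟩ rfl]
  refine ⟨_, ⟨Set.mem_univ _, γ, _, _, _, _, hγ, ?_, ?_, ?_, rfl⟩, rfl⟩
  · rw [← ncard_flatRows hsk hkj hje, ← Set.ncard_image_of_injective _ hli.injective,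
      Set.ncard_eq_toFinset_card']
    exact finrank_span_set_eq_card (hli.linearIndepOn _).id_image
  · exact hli.notMem_span_image fun hmem => hmem.2 rfl
  · simp

/-- Given independent rows for the block and a base point, there is an affine permutation of `𝒜`
which acts by the rows on the block and by translation outside of it. -/
theorem exists_affine_of_linearIndependent [Finite F] {φ : Blk m s e → Blk m s e → K}
    (hφ : LinearIndependent K φ) (P₀ : cart A) :
    ∃ σ ∈ affGroup A, ∀ P : cart A,
      (∀ i : Blk m s e, (σ P).1 i = ((blkDual hK P - blkDual hK P₀) (φ i) : K)) ∧
      ∀ i : Fin m, ¬ (s ≤ i.val ∧ i.val < e) → (σ P).1 i = P.1 i - P₀.1 i := by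
  classical
  let M : Matrix (Fin m) (Fin m) F := fun i l =>
    if hi : s ≤ i.val ∧ i.val < e then
      if hl : s ≤ l.val ∧ l.val < e then (φ ⟨i, hi⟩ ⟨l, hl⟩ : F) else 0
    else if i = l then 1 else 0
  have hin : ∀ (v : Fin m → F) (i : Blk m s e),
      M.mulVec v i = ∑ l : Blk m s e, (φ i l : F) * v l := by
    intro v i
    rw [Matrix.mulVec, dotProduct,
      ← Fintype.sum_subtype_add_sum_subtype (fun l : Fin m => s ≤ l.val ∧ l.val < e)]
    rw [Finset.sum_congr rfl fun l _ => by
      rw [show M i.1 l.1 = φ i l by simp only [M, dif_pos i.2, dif_pos l.2]]]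
    refine add_eq_left.2 (Finset.sum_eq_zero fun l _ => ?_)
    rw [show M i.1 l.1 = 0 by simp only [M, dif_pos i.2, dif_neg l.2], zero_mul]
  have hout : ∀ (v : Fin m → F) (i : Fin m), ¬ (s ≤ i.val ∧ i.val < e) →
      M.mulVec v i = v i := by
    intro v i hi
    rw [Matrix.mulVec, dotProduct]
    simp only [M, dif_neg hi, ite_mul, one_mul, zero_mul, Finset.sum_ite_eq, Finset.mem_univ,
      if_true]
  have hN : IsUnit ((Matrix.of φ).map (algebraMap K F)) :=
    (Matrix.linearIndependent_rows_iff_isUnit.1 hφ).map (algebraMap K F).mapMatrix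
  have hM : Function.Injective M.mulVec := by
    intro v w hvw
    have hB : (fun l : Blk m s e => v l) = fun l : Blk m s e => w l := by
      apply Matrix.mulVec_injective_iff_isUnit.2 hN
      ext i
      have := congrFun hvw i
      rw [hin, hin] at this
      exact this
    ext i
    by_cases hi : s ≤ i.val ∧ i.val < e
    · exact congrFun hB ⟨i, hi⟩
    · rw [← hout v i hi, hvw, hout w i hi]
  obtain ⟨M', hM'⟩ := Matrix.mulVec_injective_iff_isUnit.1 hM
  have hsub : ∀ P : cart A, M.mulVec P.1 + -M.mulVec P₀.1 = M.mulVec (P.1 - P₀.1) := fun P => by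
    rw [Matrix.mulVec_sub, sub_eq_add_neg]
  have hblk : ∀ (P : cart A) (i : Blk m s e),
      M.mulVec (P.1 - P₀.1) i = ((blkDual hK P - blkDual hK P₀) (φ i) : K) := fun P i => by
    rw [hin, coe_blkDual_sub_apply]
    rfl
  let σ : cart A → cart A := fun P => ⟨M.mulVec (P.1 - P₀.1), fun i => by
    by_cases hi : s ≤ i.val ∧ i.val < e
    · rw [hblk P ⟨i, hi⟩, hK i hi]
      exact Subtype.prop _
    · rw [hout _ i hi]
      exact sub_mem (P.2 i) (P₀.2 i)⟩
  have hinj : Function.Injective σ := fun P Q hPQ =>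
    Subtype.ext (sub_left_injective (hM (Subtype.mk.inj hPQ)))
  refine ⟨σ, ⟨Finite.injective_iff_surjective.1 hinj, M', -M.mulVec P₀.1, fun P => ?_⟩,
    fun P => ⟨hblk P, fun i hi => hout _ i hi⟩⟩
  rw [hM', hsub]

/-- Every glued word lies in an orbit. -/
theorem exists_affine_of_glue [Finite F] {j k : Fin m} (hsk : s ≤ k.val) (hkj : k ≤ j)
    (hje : j.val < e) (c : ∀ i : Low m s, A i) {ℓ : ℕ} {g : Dual K (Blk m s e → K) → F}
    (hg : g ∈ flatWords F (Blk m s e → K) (j.val - s) ℓ) :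
    ∃ (Ω : Finset K) (γ : Fˣ), Ω.card = ℓ ∧ ∃ σ ∈ affGroup A, glue hK (c, g) =
      fun P => (γ : F) * ev A (hPoly A j k (Ω.map (Function.Embedding.subtype _))) (σ P) := by
  classical
  obtain ⟨γ, U, ξ, f, Ω, hγ, hU, hf, hΩ, rfl⟩ := hg
  let kb : Blk m s e := ⟨k, hsk, lt_of_le_of_lt hkj hje⟩
  have hkS : kb ∉ flatRows s e j k := fun hmem => hmem.2 rfl
  have hcard : finrank K U = Fintype.card (flatRows s e j k) := by
    rw [hU, ← ncard_flatRows hsk hkj hje, ← Nat.card_eq_fintype_card, Nat.card_coe_set_eq]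
  let bU : Basis (flatRows s e j k) K U :=
    (finBasisOfFinrankEq K U hcard).reindex (Fintype.equivFin _).symm
  let φ₀ : Blk m s e → Blk m s e → K := fun i =>
    if hi : i ∈ flatRows s e j k then bU ⟨i, hi⟩ else f
  have hφS : ∀ i : flatRows s e j k, φ₀ i = bU i := fun i => by simp only [φ₀, dif_pos i.2]
  have hφk : φ₀ kb = f := by simp only [φ₀, dif_neg hkS]
  have hspan : Submodule.span K (φ₀ '' flatRows s e j k) = U := by
    have h1 : φ₀ '' flatRows s e j k = U.subtype '' Set.range bU := by
      ext v
      constructor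
      · rintro ⟨i, hi, rfl⟩
        exact ⟨_, ⟨⟨i, hi⟩, rfl⟩, (hφS ⟨i, hi⟩).symm⟩
      · rintro ⟨_, ⟨i, rfl⟩, rfl⟩
        exact ⟨i, i.2, hφS i⟩
    rw [h1, Submodule.span_image, bU.span_eq, Submodule.map_top, Submodule.range_subtype]
  have hli : LinearIndepOn K φ₀ (insert kb (flatRows s e j k)) := by
    rw [linearIndepOn_insert hkS, hspan, hφk]
    refine ⟨?_, hf⟩
    have heq : (fun i : flatRows s e j k => φ₀ i) = U.subtype ∘ bU := funext hφS
    rw [LinearIndepOn, heq]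
    exact bU.linearIndependent.map' U.subtype (Submodule.ker_subtype U)
  obtain ⟨φ, hφ, hext⟩ := exists_linearIndependent_extending (by simp) hli
  have himg : φ '' flatRows s e j k = φ₀ '' flatRows s e j k :=
    Set.image_congr fun i hi => hext i (Set.mem_insert_of_mem _ hi)
  rw [← himg] at hspan
  have hk := (hext kb (Set.mem_insert _ _)).trans hφk
  subst hspan hk
  obtain ⟨x₀, rfl⟩ := LinearMap.exists_extend ξ
  obtain ⟨P₀, rfl, rfl⟩ := exists_point_dual hK c x₀
  obtain ⟨σ, hσ, hσP⟩ := exists_affine_of_linearIndependent hK hφ P₀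
  -- This translate undoes the shift of `Ω` in `word_eq_glue`.
  refine ⟨Ω.map (Equiv.subRight (blkDual hK P₀ (φ kb))).toEmbedding, Units.mk0 γ hγ, by simpa,
    σ, hσ, ?_⟩
  have hlow : ∀ P, lowPart s (σ P) = 0 ↔ lowPart s P = lowPart s P₀ := by
    intro P
    rw [funext_iff, funext_iff]
    refine forall_congr' fun i => ?_
    rw [Subtype.ext_iff, Subtype.ext_iff]
    simp only [lowPart, (hσP P).2 i.1 (fun h => not_lt.2 h.1 i.2)]
    exact sub_eq_zero
  rw [Units.val_mk0, word_eq_glue hK hsk hkj hje hlow (fun P _ => (hσP P).1) kb rfl]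
  congr 3
  ext ω
  simp

end Orbit

end NestedCartesian

namespace NestedCartesian

/-! ### Block boundaries, uniqueness of the decomposition, and the final count. -/

section Blocks

variable {lam : ℕ} (μ : Fin lam → ℕ)

theorem blockSum_mono : Monotone (blockSum μ) := fun _ _ h =>
  Finset.sum_le_sum_of_subset fun i hi => by
    simp only [Finset.mem_filter, Finset.mem_univ, true_and] at hi ⊢
    omega

theorem blockSum_succ (t : Fin lam) : blockSum μ (t.val + 1) = blockSum μ t.val + μ t := by
  have h : (Finset.univ.filter fun i : Fin lam => i.val < t.val + 1) =
      insert t (Finset.univ.filter fun i : Fin lam => i.val < t.val) := by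
    ext i
    simp only [Finset.mem_filter, Finset.mem_univ, true_and, Finset.mem_insert, Fin.ext_iff]
    omega
  rw [blockSum, h, Finset.sum_insert (by simp), add_comm]
  rfl

theorem blockSum_eq_sum : blockSum μ lam = ∑ t, μ t := by
  simp [blockSum]

theorem exists_inBlock {N : ℕ} (hN : N ≤ lam) {i : ℕ} (hi : i < blockSum μ N) :
    ∃ t : Fin lam, t.val < N ∧ InBlock μ t i := by
  induction N with
  | zero => simp [blockSum] at hi
  | succ N ih =>
    by_cases h : i < blockSum μ N
    · obtain ⟨t, ht, htb⟩ := ih (by omega) h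
      exact ⟨t, by omega, htb⟩
    · exact ⟨⟨N, hN⟩, by simp, not_lt.1 h, hi⟩

variable {F : Type*} [Field F] {μ} {m : ℕ} {A : Fin m → Subfield F}

/-- The field at a coordinate past a block boundary is not contained in the field at a coordinate
before it. -/
theorem not_le_of_blockSum_le {E : Fin lam → Subfield F} (hE : StrictMono E)
    (hm : ∑ t, μ t = m) (hA : ∀ (t : Fin lam) (i : Fin m), InBlock μ t i.val → A i = E t)
    {N : ℕ} (hN : N ≤ lam) {i l : Fin m} (hi : i.val < blockSum μ N)
    (hl : blockSum μ N ≤ l.val) : ¬ A l ≤ A i := by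
  obtain ⟨t, htN, ht⟩ := exists_inBlock μ hN hi
  obtain ⟨t', -, ht'⟩ := exists_inBlock μ le_rfl (i := l.val)
    (by rw [blockSum_eq_sum, hm]; exact l.2)
  have hNt : N ≤ t'.val := by
    by_contra hcon
    have h1 := blockSum_mono μ (show t'.val + 1 ≤ N by omega)
    have h2 := ht'.2
    omega
  rw [hA t i ht, hA t' l ht']
  exact (hE (Fin.lt_def.2 (by omega))).not_ge

end Blocks

section Decomp

variable {F : Type*} [Field F] {m : ℕ} {A : Fin m → Subfield F}

/-- If `j' < j`, the sum for `j` already contains `d_{j'} - 1 ≥ ℓ'`, and adding `ℓ > 0` exceeds `u`.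
-/
theorem IsDecomp.not_lt {u ℓ ℓ' : ℕ} {j j' : Fin m} (h : IsDecomp A u j ℓ)
    (h' : IsDecomp A u j' ℓ') : ¬ j' < j := by
  intro hlt
  have hsub : insert j' (Finset.univ.filter fun i : Fin m => i < j') ⊆
      Finset.univ.filter fun i : Fin m => i < j := by
    intro i hi
    simp only [Finset.mem_filter, Finset.mem_univ, true_and, Finset.mem_insert] at hi ⊢
    rcases hi with rfl | hi
    · exact hlt
    · exact hi.trans hlt
  have hle := Finset.sum_le_sum_of_subset (f := fun i => fieldCard A i - 1) hsub
  rw [Finset.sum_insert (by simp)] at hle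
  obtain ⟨h1, -, h3⟩ := h
  obtain ⟨-, h2', h3'⟩ := h'
  omega

/-- The decomposition `u = ∑_{i < j} (d_i - 1) + ℓ` is unique. -/
theorem IsDecomp.unique {u ℓ ℓ' : ℕ} {j j' : Fin m} (h : IsDecomp A u j ℓ)
    (h' : IsDecomp A u j' ℓ') : j' = j ∧ ℓ' = ℓ := by
  obtain rfl : j' = j := le_antisymm (_root_.not_lt.1 (h'.not_lt h))
    (_root_.not_lt.1 (h.not_lt h'))
  have h1 := h.2.2
  have h2 := h'.2.2
  exact ⟨rfl, by omega⟩

end Decomp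

section Count

open Module

theorem card_blk {m s e : ℕ} (he : e ≤ m) : Fintype.card (Blk m s e) = e - s := by
  rw [← Nat.card_Ico, ← Fintype.card_coe]
  refine Fintype.card_congr ⟨fun i => ⟨i.1.val, Finset.mem_Ico.2 i.2⟩,
    fun n => ⟨⟨n, (Finset.mem_Ico.1 n.2).2.trans_le he⟩, Finset.mem_Ico.1 n.2⟩,
    fun _ => rfl, fun _ => rfl⟩

theorem ne_zero_of_mem_flatWords {K F D : Type*} [Field K] [Finite K] [Field F] [Algebra K F]
    [AddCommGroup D] [Module K D] {a ℓ : ℕ} (hℓ : ℓ + 2 ≤ Nat.card K) {g : Dual K D → F}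
    (hg : g ∈ flatWords F D a ℓ) : g ≠ 0 := by
  obtain ⟨γ, U, ξ, f, Ω, hγ, -, hf, hΩ, rfl⟩ := hg
  obtain ⟨c, -, hc, -⟩ := exists_notMem_pair (hΩ ▸ hℓ : Ω.card + 2 ≤ Nat.card K)
  obtain ⟨x, hx, hxf⟩ := exists_dual_extending U ξ hf c
  exact Function.ne_iff.2 ⟨x, (flatWord_ne_zero_iff hγ).2 ⟨hx, hxf ▸ hc⟩⟩

variable {F : Type*} [Field F] {m : ℕ} {A : Fin m → Subfield F} {s e : ℕ} {K : Subfield F}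

/-- The product counts the lower parts `c` times the functionals `ξ` on a space of dimension `j -
s`. -/
theorem prod_fieldCard_eq (hK : ∀ i : Fin m, s ≤ i.val ∧ i.val < e → A i = K) {j k : Fin m}
    (hsk : s ≤ k.val) (hkj : k ≤ j) (hje : j.val < e) :
    ∏ i : Fin m with i ≤ j ∧ i ≠ k, fieldCard A i =
      (∏ i : Low m s, fieldCard A i) * Nat.card K ^ (j.val - s) := by
  have hlow : ((Finset.univ.filter fun i : Fin m => i ≤ j ∧ i ≠ k).filter fun i => i.val < s) =
      Finset.univ.filter fun i : Fin m => i.val < s := by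
    ext i
    simp only [Finset.mem_filter, Finset.mem_univ, true_and, Fin.le_def, ne_eq, Fin.ext_iff]
    have := Fin.le_def.1 hkj
    omega
  have hrows : (((Finset.univ.filter fun i : Fin m => i ≤ j ∧ i ≠ k).filter
      fun i => ¬ i.val < s : Finset (Fin m)) : Set (Fin m)) =
      Subtype.val '' flatRows s e j k := by
    ext i
    simp only [Finset.coe_filter, Finset.mem_filter, Finset.mem_univ, true_and, Set.mem_ofPred_eq,
      not_lt, Set.mem_image, flatRows, Subtype.exists, exists_and_right, exists_eq_right]
    have hie : i ≤ j → i.val < e := fun h => lt_of_le_of_lt h hje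
    tauto
  rw [← Finset.prod_filter_mul_prod_filter_not _ (fun i : Fin m => i.val < s), hlow]
  congr 1
  · exact (Finset.prod_subtype _ (by simp) _)
  · rw [Finset.prod_congr rfl (g := fun _ => Nat.card K), Finset.prod_const,
      ← Set.ncard_coe_finset, hrows, Set.ncard_image_of_injective _ Subtype.val_injective,
      ncard_flatRows hsk hkj hje]
    intro i hi
    simp only [Finset.mem_filter, Finset.mem_univ, true_and, not_lt] at hi
    rw [fieldCard, hK i ⟨hi.2, lt_of_le_of_lt hi.1.1 hje⟩]

/-- The words of `N^{(k)}(u, 𝒜)` are the glued words. -/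
theorem words_eq_image_glue [Finite F]
    (hK : ∀ i : Fin m, s ≤ i.val ∧ i.val < e → A i = K)
    (hlow : ∀ i l : Fin m, i.val < s → s ≤ l.val → ¬ A l ≤ A i)
    (hhigh : ∀ i l : Fin m, i.val < e → e ≤ l.val → ¬ A l ≤ A i)
    {j k : Fin m} (hsk : s ≤ k.val) (hkj : k ≤ j) (hje : j.val < e) {u ℓ : ℕ}
    (hu : IsDecomp A u j ℓ) :
    words A u k = glue hK '' (Set.univ ×ˢ flatWords F (Blk m s e → K) (j.val - s) ℓ) := by
  classical
  have hAk : A k = K := hK k ⟨hsk, lt_of_le_of_lt hkj hje⟩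
  have hdk : fieldCard A k = Nat.card K := by rw [fieldCard, hAk]
  have hdj : fieldCard A j = Nat.card K := by
    rw [fieldCard, hK j ⟨hsk.trans hkj, hje⟩]
  have hle := hu.2.1
  have hcard : ∀ n : ℕ, n + (fieldCard A j - ℓ) = fieldCard A k ↔ n = ℓ := by
    intro n
    have : 0 < Nat.card K := Nat.card_pos
    omega
  ext w
  constructor
  · rintro ⟨j', ℓ', hu', Ω, hΩ, hΩc, γ, σ, hσ, rfl⟩
    obtain ⟨rfl, rfl⟩ := hu.unique hu'
    rw [hcard] at hΩc
    rw [hAk] at hΩ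
    have hΩeq : (Ω.subtype (· ∈ K)).map (Function.Embedding.subtype _) = Ω :=
      Finset.subtype_map_of_mem hΩ
    have := exists_glue_of_affine hK hlow hhigh hsk hkj hje hσ γ.ne_zero (Ω.subtype (· ∈ K))
    rw [← Finset.card_map (Function.Embedding.subtype _), hΩeq, hΩc] at this
    exact this
  · rintro ⟨⟨c, g⟩, ⟨-, hg⟩, rfl⟩
    obtain ⟨Ω, γ, hΩ, σ, hσ, h⟩ := exists_affine_of_glue hK hsk hkj hje c hg
    refine ⟨j, ℓ, hu, Ω.map (Function.Embedding.subtype _), fun ω hω => ?_, ?_, γ, σ, hσ, h⟩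
    · obtain ⟨ω', -, rfl⟩ := Finset.mem_map.1 hω
      rw [hAk]
      exact ω'.2
    · rw [hcard, Finset.card_map, hΩ]

end Count

end NestedCartesian

theorem mainTheorem3 {F : Type*} [Field F] [Finite F]
    -- the distinct nested subfields and their multiplicities
    {lam : ℕ} (E : Fin lam → Subfield F) (hE : StrictMono E)
    (μ : Fin lam → ℕ) (hμ : ∀ t, 0 < μ t)
    -- `𝒜 = A_1 × ⋯ × A_m`, where each `F_t` is repeated `μ_t` times
    {m : ℕ} (hm : ∑ t, μ t = m) (A : Fin m → Subfield F)
    (hA : ∀ (t : Fin lam) (i : Fin m), NestedCartesian.InBlock μ t i.val → A i = E t)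
    -- `u = ∑_{i=1}^{j} (d_i - 1) + ℓ` with `0 ≤ j < m` and `0 < ℓ < d_{j+1} - 1`
    (u ℓ : ℕ) (j : Fin m) (hℓ : 0 < ℓ) (hℓ' : ℓ < NestedCartesian.fieldCard A j - 1)
    (hu : u = (∑ i : Fin m with i < j, (NestedCartesian.fieldCard A i - 1)) + ℓ)
    -- `r = t_{j+1}`, `1 ≤ k ≤ j + 1` and `t_k = r`
    (r : Fin lam) (hr : NestedCartesian.InBlock μ r j.val)
    (k : Fin m) (hkj : k ≤ j) (hk : NestedCartesian.InBlock μ r k.val) :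
    (NestedCartesian.words A u k).ncard =
      (Nat.card F - 1) *
        (∏ i : Fin m with i ≤ j ∧ i ≠ k, NestedCartesian.fieldCard A i) *
        NestedCartesian.gaussBinom (A j) (μ r) (j.val - NestedCartesian.blockSum μ r.val) *
        NestedCartesian.gaussBinom (A k) (NestedCartesian.blockSum μ (r.val + 1) - j.val) 1 *
        (NestedCartesian.fieldCard A k).choose (NestedCartesian.fieldCard A j - ℓ) := by
  open NestedCartesian in
  have hsucc := blockSum_succ μ r
  have hK : ∀ i : Fin m, blockSum μ r.val ≤ i.val ∧ i.val < blockSum μ (r.val + 1) → A i = E r :=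
    fun i hi => hA r i hi
  have hem : blockSum μ (r.val + 1) ≤ m := by
    rw [← hm, ← blockSum_eq_sum]
    exact blockSum_mono μ r.2
  have hdk : fieldCard A k = Nat.card (E r) := by rw [fieldCard, hA r k hk]
  have hdj : fieldCard A j = Nat.card (E r) := by rw [fieldCard, hA r j hr]
  -- The strict bound on `ℓ` leaves two elements of the field outside `Ω`, as injectivity requires.
  have hℓ2 : ℓ + 2 ≤ Nat.card (E r) := by omega
  have hwords := words_eq_image_glue hK
    (fun i l => not_le_of_blockSum_le hE hm hA r.2.le)
    (fun i l => not_le_of_blockSum_le hE hm hA r.2) hk.1 hkj hr.2 ⟨hℓ, hℓ'.le, hu⟩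
  have hrank : Module.finrank (E r) (Blk m (blockSum μ r.val) (blockSum μ (r.val + 1)) → E r) =
      μ r := by
    rw [Module.finrank_fintype_fun_eq_card, card_blk hem, hsucc, Nat.add_sub_cancel_left]
  have hsub : μ r - (j.val - blockSum μ r.val) = blockSum μ (r.val + 1) - j.val := by
    have := hr.1
    omega
  rw [hwords, (glue_injOn hK fun g hg => ne_zero_of_mem_flatWords hℓ2 hg).ncard_image,
    Set.ncard_prod, Set.ncard_univ, natCard_lowPart, ncard_flatWords hrank hℓ hℓ2, hsub,
    prod_fieldCard_eq hK hk.1 hkj hr.2, hdk, hdj, hA r j hr, hA r k hk,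
    Nat.choose_symm (by omega)]
  ring
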